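/- For $n\ge 1$ let the straight linear 2-tree $G_n$ be the graph with vertex set $\{1,2,\dots,n\}$ in which $i$ and $j$ are adjacent if and only if $0<|i-j|\le 2$. For integers $n$, $k$ with $3\le k\le n-3$, the bent linear 2-tree $H_n$ with a single bend at vertex $k$ is the graph on $\{1,2,\dots,n\}$ obtained from $G_n$ by adding the edge $\{k,k+3\}$ and removing the edge $\{k+1,k+3\}$. All edges have weight $1$. The effective resistance (resistance distance) between two vertices $i,j$ of a graph with Laplacian matrix $L$ is $r(i,j)=(\mathbf e_i-\mathbf e_j)^{T}L^{\dagger}(\mathbf e_i-\mathbf e_j)$, where $L^\dagger$ is the Moore–Penrose inverse of $L$. Theorem. Let $H_n$ be the bent linear 2-tree with $n$ vertices and a single bend at vertex $k\in\{3,4,\dots,n-3\}$, and let $m=n-2$ (the number of its triangles). Then the effective resistance between vertex $1$ and vertex $n$ of $H_n$ is $$r_{m,k}(1,n)=\frac{m+1}{5}+\frac{4F_{m+1}}{5L_{m+1}}+\frac{\sum_{j=3}^{k}(-1)^jF_{m-2j+3}\left(F_{m+2}+F_{j-2}F_{m-j+1}\right)}{F_{2m+2}},$$ where $F_p$ is the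 $p$th Fibonacci number, $p\in\mathbb Z$ ($F_0=0$, $F_1=1$, $F_{p+2}=F_{p+1}+F_p$ for all integers $p$, so that $F_{-p}=(-1)^{p+1}F_p$), and $L_q$ is the $q$th Lucas number ($L_0=2$, $L_1=1$, $L_{q+2}=L_{q+1}+L_q$). -/

import Mathlib

open scoped Matrix

/-- `X` is a Moore–Penrose inverse of the real matrix `A`: the four Penrose equations. -/
structure IsMoorePenroseInverse {m n : Type*} [Fintype m] [Fintype n]
    (A : Matrix m n ℝ) (X : Matrix n m ℝ) : Prop where
  mul_inv_mul : A * X * A = A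
  inv_mul_inv : X * A * X = X
  isSymm_mul_inv : (A * X).IsSymm
  isSymm_inv_mul : (X * A).IsSymm

/-- Uniqueness of the Moore–Penrose inverse. -/
theorem IsMoorePenroseInverse.unique {m n : Type*} [Fintype m] [Fintype n]
    {A : Matrix m n ℝ} {X Y : Matrix n m ℝ}
    (hX : IsMoorePenroseInverse A X) (hY : IsMoorePenroseInverse A Y) : X = Y := by
  have h1 : A * X = A * Y := by
    have e : (A * Y) * (A * X) = A * X := by rw [← Matrix.mul_assoc, hY.mul_inv_mul]
    have e' := congrArg Matrix.transpose e
    rw [Matrix.transpose_mul, hX.isSymm_mul_inv.eq, hY.isSymm_mul_inv.eq,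
      ← Matrix.mul_assoc, hX.mul_inv_mul] at e'
    exact e'.symm
  have h2 : X * A = Y * A := by
    have e : (X * A) * (Y * A) = X * A := by
      rw [Matrix.mul_assoc, ← Matrix.mul_assoc A, hY.mul_inv_mul]
    have e' := congrArg Matrix.transpose e
    rw [Matrix.transpose_mul, hX.isSymm_inv_mul.eq, hY.isSymm_inv_mul.eq,
      Matrix.mul_assoc, ← Matrix.mul_assoc A, hX.mul_inv_mul] at e'
    exact e'.symm
  rw [← hX.inv_mul_inv, h2, Matrix.mul_assoc, h1, ← Matrix.mul_assoc, hY.inv_mul_inv]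

/-- A real symmetric matrix has a symmetric Moore–Penrose inverse. -/
theorem exists_isMoorePenroseInverse_of_isSymm {n : Type*} [Fintype n]
    (B : Matrix n n ℝ) (hB : B.IsSymm) :
    ∃ X : Matrix n n ℝ, IsMoorePenroseInverse B X ∧ X.IsSymm := by
  classical
  have hH : B.IsHermitian := by
    rw [Matrix.IsHermitian, Matrix.conjTranspose_eq_transpose_of_trivial]; exact hB
  obtain ⟨φ, d, hφ⟩ : ∃ (φ : Matrix n n ℝ ≃⋆ₐ[ℝ] Matrix n n ℝ) (d : n → ℝ),
      B = φ (Matrix.diagonal d) := ⟨_, _, hH.spectral_theorem⟩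
  have hs : ∀ e : n → ℝ, (φ (Matrix.diagonal e)).IsSymm := by
    intro e
    have h := map_star φ (Matrix.diagonal e)
    rw [Matrix.star_eq_conjTranspose, Matrix.star_eq_conjTranspose,
      Matrix.conjTranspose_eq_transpose_of_trivial,
      Matrix.conjTranspose_eq_transpose_of_trivial, Matrix.diagonal_transpose] at h
    exact h.symm
  refine ⟨φ (Matrix.diagonal fun i => (d i)⁻¹), ⟨?_, ?_, ?_, ?_⟩, hs _⟩
  · rw [hφ, ← map_mul, ← map_mul, Matrix.diagonal_mul_diagonal, Matrix.diagonal_mul_diagonal]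
    simp
  · rw [hφ, ← map_mul, ← map_mul, Matrix.diagonal_mul_diagonal, Matrix.diagonal_mul_diagonal]
    congr 2
    funext i
    by_cases h : d i = 0 <;> simp [h]
  · rw [hφ, ← map_mul, Matrix.diagonal_mul_diagonal]; exact hs _
  · rw [hφ, ← map_mul, Matrix.diagonal_mul_diagonal]; exact hs _

/-- Every real matrix has a Moore–Penrose inverse. -/
theorem exists_isMoorePenroseInverse {m n : Type*} [Fintype m] [Fintype n]
    (A : Matrix m n ℝ) : ∃ X : Matrix n m ℝ, IsMoorePenroseInverse A X := by
  classical
  obtain ⟨Y, hY, hYs⟩ := exists_isMoorePenroseInverse_of_isSymm (Aᵀ * A)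
    (by rw [Matrix.IsSymm, Matrix.transpose_mul, Matrix.transpose_transpose])
  refine ⟨Y * Aᵀ, ⟨?_, ?_, ?_, ?_⟩⟩
  · have h : Aᵀ * A * (Y * (Aᵀ * A) - 1) = 0 := by
      rw [Matrix.mul_sub, ← Matrix.mul_assoc, hY.mul_inv_mul, Matrix.mul_one, sub_self]
    rw [← Matrix.conjTranspose_eq_transpose_of_trivial A,
      Matrix.conjTranspose_mul_self_mul_eq_zero, Matrix.mul_sub, Matrix.mul_one, sub_eq_zero,
      Matrix.conjTranspose_eq_transpose_of_trivial] at h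
    simpa only [Matrix.mul_assoc] using h
  · have h := congrArg (· * Aᵀ) hY.inv_mul_inv
    simpa only [Matrix.mul_assoc] using h
  · rw [Matrix.IsSymm, Matrix.transpose_mul, Matrix.transpose_mul, Matrix.transpose_transpose,
      hYs.eq, Matrix.mul_assoc]
  · rw [Matrix.mul_assoc]; exact hY.isSymm_inv_mul

/-- The Moore–Penrose inverse of a real matrix. -/
noncomputable def moorePenroseInverse {m n : Type*} [Fintype m] [Fintype n]
    (A : Matrix m n ℝ) : Matrix n m ℝ :=
  (exists_isMoorePenroseInverse A).choose

/-- The defining property of `moorePenroseInverse`. -/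
theorem moorePenroseInverse_spec {m n : Type*} [Fintype m] [Fintype n] (A : Matrix m n ℝ) :
    IsMoorePenroseInverse A (moorePenroseInverse A) :=
  (exists_isMoorePenroseInverse A).choose_spec

open Classical in
/-- The effective resistance (resistance distance) `(eᵢ - eⱼ)ᵀ L† (eᵢ - eⱼ)` between the vertices
`i` and `j` of a graph all of whose edges have weight one, where `L` is the graph Laplacian. -/
noncomputable def resistanceDistance {V : Type*} [Fintype V] (G : SimpleGraph V) (i j : V) : ℝ :=
  (Pi.single i 1 - Pi.single j 1 : V → ℝ) ⬝ᵥ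
    (moorePenroseInverse (G.lapMatrix ℝ) *ᵥ (Pi.single i 1 - Pi.single j 1 : V → ℝ))

/-- The label in `{1, …, n}` of an element of `Fin n`. -/
def vertexLabel {n : ℕ} (i : Fin n) : ℕ := (i : ℕ) + 1

/-- The straight linear 2-tree on the vertices `1, …, n`: vertices with labels `a` and `b` are
adjacent exactly when `0 < |a - b| ≤ 2`. -/
def straightLinearTwoTree (n : ℕ) : SimpleGraph (Fin n) where
  Adj i j := 0 < |(vertexLabel i : ℤ) - vertexLabel j| ∧
    |(vertexLabel i : ℤ) - vertexLabel j| ≤ 2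
  symm := ⟨fun i j h => by rwa [abs_sub_comm]⟩
  loopless := ⟨fun i h => by simp at h⟩

/-- The bent linear 2-tree on the vertices `1, …, n` with a single bend at vertex `k`: the
straight linear 2-tree with the edge `{k, k + 3}` added and the edge `{k + 1, k + 3}` removed. -/
def bentLinearTwoTree (n k : ℕ) : SimpleGraph (Fin n) where
  Adj i j := ((straightLinearTwoTree n).Adj i j ∨
      s(vertexLabel i, vertexLabel j) = s(k, k + 3)) ∧
    s(vertexLabel i, vertexLabel j) ≠ s(k + 1, k + 3)
  symm := ⟨fun i j h => by
    rw [Sym2.eq_swap, (straightLinearTwoTree n).adj_comm]; exact h⟩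
  loopless := ⟨fun i h => by
    rcases h.1 with h | h
    · exact (straightLinearTwoTree n).irrefl h
    · rw [Sym2.eq_iff] at h; omega⟩

/-- The Lucas numbers: `L₀ = 2`, `L₁ = 1`, `L_{q+2} = L_q + L_{q+1}`. -/
def lucasNumber : ℕ → ℕ
  | 0 => 2
  | 1 => 1
  | q + 2 => lucasNumber q + lucasNumber (q + 1)

/-! The resistance is the drop of any potential `v` with `L v = e₁ - eₙ`, so it suffices to exhibit
one. Inside a straight arm the balance equation is a linear recurrence with characteristic
polynomial `(x - 1)² (x² + 3x + 1)`, solved by `1`, `i`, `(-1)^i F_{2i}` and `(-1)^i F_{2i+1}`. The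
conditions at the end vertex leave one free parameter (`straightPotential`).

Read from the last vertex, the far side of the bend is straight too, once the two vertices shared by
the arms are swapped (`farArm`). Take `X` on the near arm and `C - Y` on the far one. Agreement and
balance at the two shared vertices determine `α`, `β` and `C` (`gluing_identities`); up to sign the
determinant is `F_{2m+2}`, the denominator of the formula.

On the other side, `sum_fib_eq_lucas` telescopes the sum and `F_{2n} = F_n L_n` gives a common
denominator; `resistance_numerator_eq` then matches the numerators. -/

/-! ### Resistance from potentials -/

/-- If `L v = eᵢ - eⱼ`, the resistance distance is the potential difference `v i - v j`. -/
theorem resistanceDistance_eq_of_lapMatrix_mulVec {V : Type*} [Fintype V] [DecidableEq V]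
    (G : SimpleGraph V) [DecidableRel G.Adj] (i j : V) (v : V → ℝ)
    (hv : G.lapMatrix ℝ *ᵥ v = Pi.single i 1 - Pi.single j 1) :
    resistanceDistance G i j = v i - v j := by
  have h : resistanceDistance G i j = (Pi.single i 1 - Pi.single j 1 : V → ℝ) ⬝ᵥ
      (moorePenroseInverse (G.lapMatrix ℝ) *ᵥ (Pi.single i 1 - Pi.single j 1 : V → ℝ)) := by
    unfold resistanceDistance
    congr!
  -- `(L v)ᵀ L† (L v) = vᵀ (L L† L) v = vᵀ L v`, by symmetry and the first Penrose equation.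
  rw [h, ← hv, Matrix.mulVec_mulVec, Matrix.dotProduct_mulVec, Matrix.vecMul_mulVec]
  rw [(G.isSymm_lapMatrix (R := ℝ)).eq, ← Matrix.mul_assoc,
    (moorePenroseInverse_spec (G.lapMatrix ℝ)).mul_inv_mul, ← (G.isSymm_lapMatrix (R := ℝ)).eq,
    Matrix.vecMul_transpose, hv]
  simp [sub_dotProduct]

/-- The Laplacian at a vertex whose neighbours are listed in a set of numbers. -/
theorem lapMatrix_mulVec_apply_of_adj_iff {n : ℕ} (G : SimpleGraph (Fin n)) [DecidableRel G.Adj]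
    (v : ℕ → ℝ) (i : Fin n) (S : Finset ℕ) (hS : ∀ a ∈ S, a < n)
    (h : ∀ j : Fin n, G.Adj i j ↔ (j : ℕ) ∈ S) :
    (G.lapMatrix ℝ *ᵥ fun a => v a) i = ∑ a ∈ S, (v i - v a) := by
  have e : S = (G.neighborFinset i).map Fin.valEmbedding := by
    ext a
    simp only [Finset.mem_map, SimpleGraph.mem_neighborFinset, h, Fin.valEmbedding_apply]
    exact ⟨fun ha => ⟨⟨a, hS a ha⟩, ha, rfl⟩, by rintro ⟨j, hj, rfl⟩; exact hj⟩
  rw [SimpleGraph.lapMatrix_mulVec_apply, e, Finset.sum_map]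
  simp [Finset.sum_sub_distrib]

/-! ### Potentials on a straight arm -/

/-- A potential on a straight linear 2-tree with unit current entering at the end vertex `0`. -/
noncomputable def straightPotential (α : ℝ) (i : ℕ) : ℝ :=
  2 / 25 + 2 * α / 5 - i / 5 + (-1) ^ i * ((α / 5 - 4 / 25) * (Nat.fib (2 * i) : ℝ) -
    (2 / 25 + 2 * α / 5) * (Nat.fib (2 * i + 1) : ℝ))

theorem straightPotential_zero (α : ℝ) : straightPotential α 0 = 0 := by
  simp [straightPotential]

theorem straightPotential_end (α : ℝ) :
    2 * straightPotential α 0 - straightPotential α 1 - straightPotential α 2 = 1 := by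
  simp [straightPotential, Nat.fib_add_two]; ring

theorem straightPotential_next (α : ℝ) :
    3 * straightPotential α 1 - straightPotential α 0 - straightPotential α 2
      - straightPotential α 3 = 0 := by
  simp [straightPotential, Nat.fib_add_two]; ring

/-- `(-1)^i F_{2i}` and `(-1)^i F_{2i+1}` are annihilated by `x² + 3x + 1`, and the affine part by
`(x - 1)²`. Slope `-1/5` carries the unit current: a cut has three edges, with index differences 1,
2, 2. -/
theorem straightPotential_inner (α : ℝ) (i : ℕ) :
    4 * straightPotential α (i + 2) - straightPotential α i - straightPotential α (i + 1)
      - straightPotential α (i + 3) - straightPotential α (i + 4) = 0 := by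
  simp [straightPotential, Nat.mul_add, Nat.fib_add_two, pow_add]
  ring

/-! ### Gluing two arms at the bend -/

theorem bentLinearTwoTree_adj_iff {n K : ℕ} (i j : Fin n) :
    (bentLinearTwoTree n (K + 3)).Adj i j ↔
      ((i : ℕ) ≠ j ∧ (i : ℕ) ≤ j + 2 ∧ (j : ℕ) ≤ i + 2 ∨
        (i : ℕ) = K + 2 ∧ (j : ℕ) = K + 5 ∨ (i : ℕ) = K + 5 ∧ (j : ℕ) = K + 2) ∧
      ¬((i : ℕ) = K + 3 ∧ (j : ℕ) = K + 5 ∨ (i : ℕ) = K + 5 ∧ (j : ℕ) = K + 3) := by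
  simp only [bentLinearTwoTree, straightLinearTwoTree, vertexLabel, abs_pos, abs_le, ne_eq,
    Sym2.eq_iff]
  omega

/-- The vertex at position `p` of the arm of `bentLinearTwoTree (K + Q + 6) (K + 3)` beyond the
bend, counted from the last vertex. -/
def farArm (K Q p : ℕ) : ℕ :=
  if p ≤ Q + 1 then K + Q + 5 - p else if p = Q + 2 then K + 2 else K + 3

/-- Two potentials of straight 2-trees that fit together at the bend give a potential of the
bent 2-tree. -/
theorem resistanceDistance_bentLinearTwoTree_of_potentials (K Q : ℕ) (X Y : ℕ → ℝ) (C : ℝ)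
    (hX0 : 2 * X 0 - X 1 - X 2 = 1) (hX1 : 3 * X 1 - X 0 - X 2 - X 3 = 0)
    (hX : ∀ i, 4 * X (i + 2) - X i - X (i + 1) - X (i + 3) - X (i + 4) = 0)
    (hY0 : 2 * Y 0 - Y 1 - Y 2 = 1) (hY1 : 3 * Y 1 - Y 0 - Y 2 - Y 3 = 0)
    (hY : ∀ i, 4 * Y (i + 2) - Y i - Y (i + 1) - Y (i + 3) - Y (i + 4) = 0)
    (h₂ : X (K + 2) = C - Y (Q + 2)) (h₃ : X (K + 3) = C - Y (Q + 3))
    (hb₂ : 5 * X (K + 2) - X K - X (K + 1) - X (K + 3) - (C - Y (Q + 1)) - (C - Y Q) = 0)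
    (hb₃ : 3 * X (K + 3) - X (K + 1) - X (K + 2) - (C - Y (Q + 1)) = 0) :
    resistanceDistance (bentLinearTwoTree (K + Q + 6) (K + 3))
      ⟨0, by omega⟩ ⟨K + Q + 5, by omega⟩ = X 0 - (C - Y 0) := by
  classical
  obtain ⟨v, hvX, hvY⟩ : ∃ v : ℕ → ℝ, (∀ i ≤ K + 3, v i = X i) ∧
      ∀ p ≤ Q + 3, v (farArm K Q p) = C - Y p := by
    refine ⟨fun i => if i ≤ K + 3 then X i else C - Y (K + Q + 5 - i), fun i hi => if_pos hi,
      fun p hp => ?_⟩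
    -- Only the two shared vertices lie in both arms; there `h₂` and `h₃` make the definitions
    -- agree.
    obtain h | rfl | rfl : p ≤ Q + 1 ∨ p = Q + 2 ∨ p = Q + 3 := by omega
    · simp only [farArm, if_pos h]
      rw [if_neg (by omega), show K + Q + 5 - (K + Q + 5 - p) = p by omega]
    · simpa [farArm] using h₂
    · simpa [farArm] using h₃
  have h0 := resistanceDistance_eq_of_lapMatrix_mulVec (bentLinearTwoTree (K + Q + 6) (K + 3))
    ⟨0, by omega⟩ ⟨K + Q + 5, by omega⟩ (fun a => v a) ?_
  · rw [h0]
    have := hvY 0 (by omega)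
    simp only [farArm, Nat.zero_le, if_true, Nat.sub_zero] at this
    rw [this, hvX 0 (by omega)]
  funext ⟨i, hi⟩
  have key := lapMatrix_mulVec_apply_of_adj_iff (bentLinearTwoTree (K + Q + 6) (K + 3)) v ⟨i, hi⟩
  simp only [bentLinearTwoTree_adj_iff] at key
  simp only [Pi.sub_apply, Pi.single_apply, Fin.mk.injEq]
  -- These vertices have all their neighbours in the near arm, where `v` is `X`.
  by_cases hl : i ≤ K + 1
  · rw [if_neg (show ¬ i = K + Q + 5 by omega)]
    obtain rfl | rfl | ⟨j, rfl⟩ : i = 0 ∨ i = 1 ∨ ∃ j, i = j + 2 := by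
      rcases i with _ | _ | j <;> simp
    · rw [key {1, 2} (by simp) (fun j => by
        simp only [Finset.mem_insert, Finset.mem_singleton]; omega)]
      simp [hvX]
      linarith
    · rw [key {0, 2, 3} (by simp) (fun j => by
        simp only [Finset.mem_insert, Finset.mem_singleton]; omega)]
      simp [hvX]
      linarith
    · rw [key {j, j + 1, j + 3, j + 4} (by simp; omega) (fun j => by
        simp only [Finset.mem_insert, Finset.mem_singleton]; omega)]
      rw [Finset.sum_insert (by simp), Finset.sum_insert (by simp), Finset.sum_insert (by simp),
        Finset.sum_singleton, hvX, hvX, hvX, hvX, hvX] <;> try omega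
      have := hX j
      simp
      linarith
  by_cases hm : i ≤ K + 3
  · rw [if_neg (show ¬ i = K + Q + 5 by omega), if_neg (show ¬ i = 0 by omega)]
    obtain rfl | rfl : i = K + 2 ∨ i = K + 3 := by omega
    · have f₁ : v (K + 4) = C - Y (Q + 1) := by
        rw [← hvY _ (by omega)]; unfold farArm; congr 1; split_ifs <;> omega
      have f₀ : v (K + 5) = C - Y Q := by
        rw [← hvY _ (by omega)]; unfold farArm; congr 1; split_ifs <;> omega
      -- The bend vertex has degree five; the next one loses `K + 5` and has degree three.
      rw [key {K, K + 1, K + 3, K + 4, K + 5} (by simp; omega) (fun j => by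
        simp only [Finset.mem_insert, Finset.mem_singleton, true_and]; omega)]
      rw [Finset.sum_insert (by simp), Finset.sum_insert (by simp), Finset.sum_insert (by simp),
        Finset.sum_insert (by simp), Finset.sum_singleton, hvX K (by omega),
        hvX (K + 1) (by omega), hvX (K + 2) (by omega), hvX (K + 3) (by omega), f₁, f₀]
      linarith
    · have f₁ : v (K + 4) = C - Y (Q + 1) := by
        rw [← hvY _ (by omega)]; unfold farArm; congr 1; split_ifs <;> omega
      rw [key {K + 1, K + 2, K + 4} (by simp; omega) (fun j => by
        simp only [Finset.mem_insert, Finset.mem_singleton, true_and]; omega)]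
      rw [Finset.sum_insert (by simp), Finset.sum_insert (by simp),
        Finset.sum_singleton,
        hvX (K + 1) (by omega), hvX (K + 2) (by omega), hvX (K + 3) (by omega), f₁]
      linarith
  obtain ⟨p, hp, rfl⟩ : ∃ p ≤ Q + 1, i = farArm K Q p :=
    ⟨K + Q + 5 - i, by omega, by unfold farArm; split_ifs <;> omega⟩
  rw [if_neg (show ¬ farArm K Q p = 0 by omega)]
  have hinj : ∀ a ≤ Q + 3, ∀ b ≤ Q + 3, a ≠ b → farArm K Q a ≠ farArm K Q b := by
    intro a ha b hb hab
    unfold farArm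
    split_ifs <;> omega
  have hlt : ∀ a, farArm K Q a < K + Q + 6 := by
    intro a
    unfold farArm
    split_ifs <;> omega
  have hnear : ∀ a ≤ Q + 1, farArm K Q a = K + Q + 5 - a := fun a ha => if_pos ha
  obtain rfl | rfl | ⟨j, rfl⟩ : p = 0 ∨ p = 1 ∨ ∃ j, p = j + 2 := by
    rcases p with _ | _ | j <;> simp
  · rw [key {farArm K Q 1, farArm K Q 2} (by simp [hlt]) (fun j => by
      simp only [Finset.mem_insert, Finset.mem_singleton]; unfold farArm; split_ifs <;> omega)]
    rw [Finset.sum_pair (hinj _ (by omega) _ (by omega) (by omega)), hvY 0 (by omega),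
      hvY 1 (by omega), hvY 2 (by omega), if_pos (by simp [farArm])]
    linarith
  · rw [key {farArm K Q 0, farArm K Q 2, farArm K Q 3} (by simp [hlt]) (fun j => by
      simp only [Finset.mem_insert, Finset.mem_singleton]; unfold farArm; split_ifs <;> omega)]
    rw [Finset.sum_insert (by
        simp only [Finset.mem_insert, Finset.mem_singleton, not_or]
        exact ⟨hinj _ (by omega) _ (by omega) (by omega), hinj _ (by omega) _ (by omega) (by omega)⟩),
      Finset.sum_pair (hinj _ (by omega) _ (by omega) (by omega)), hvY 0 (by omega),
      hvY 1 (by omega), hvY 2 (by omega), hvY 3 (by omega), if_neg (by simp [farArm])]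
    linarith
  · rw [key {farArm K Q j, farArm K Q (j + 1), farArm K Q (j + 3), farArm K Q (j + 4)}
      (by simp [hlt]) (fun a => by
        simp only [Finset.mem_insert, Finset.mem_singleton]
        have ha := a.2
        rw [hnear j (by omega), hnear (j + 1) (by omega), hnear (j + 2) hp]
        -- The cases record how many of the two neighbours nearer the bend are shared vertices:
        -- none, one or both.
        obtain h | rfl | rfl : j + 3 ≤ Q ∨ Q = j + 2 ∨ Q = j + 1 := by omega
        · rw [hnear (j + 3) (by omega), hnear (j + 4) (by omega)]
          omega
        · rw [hnear (j + 3) (by omega), show farArm K (j + 2) (j + 4) = K + 2 by simp [farArm]]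
          omega
        · rw [show farArm K (j + 1) (j + 3) = K + 2 by simp [farArm],
            show farArm K (j + 1) (j + 4) = K + 3 by simp [farArm]]
          omega)]
    rw [Finset.sum_insert (by
        simp only [Finset.mem_insert, Finset.mem_singleton, not_or]
        refine ⟨?_, ?_, ?_⟩ <;> exact hinj _ (by omega) _ (by omega) (by omega)),
      Finset.sum_insert (by
        simp only [Finset.mem_insert, Finset.mem_singleton, not_or]
        refine ⟨?_, ?_⟩ <;> exact hinj _ (by omega) _ (by omega) (by omega)),
      Finset.sum_pair (hinj _ (by omega) _ (by omega) (by omega)), hvY j (by omega),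
      hvY (j + 1) (by omega), hvY (j + 2) (by omega), hvY (j + 3) (by omega),
      hvY (j + 4) (by omega), if_neg (by unfold farArm; split_ifs; omega)]
    linarith [hY j]

/-! ### Fibonacci and Lucas identities -/

theorem neg_one_pow_eq_cast_fib (n : ℕ) : (-1 : ℝ) ^ n =
    (Nat.fib (n + 1) : ℝ) ^ 2 - Nat.fib n * Nat.fib (n + 1) - (Nat.fib n : ℝ) ^ 2 := by
  induction n with
  | zero => simp
  | succ n ih => rw [pow_succ, ih, Nat.fib_add_two]; push_cast; ring

theorem fib_two_mul_eq_mul_lucasNumber (n : ℕ) :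
    Nat.fib (2 * n) = Nat.fib n * lucasNumber n := by
  have h : ∀ n, lucasNumber n + Nat.fib n = 2 * Nat.fib (n + 1) ∧
      lucasNumber (n + 1) + Nat.fib (n + 1) = 2 * Nat.fib (n + 2) := by
    intro n
    induction n with
    | zero => simp [lucasNumber]
    | succ n ih =>
      refine ⟨ih.2, ?_⟩
      simp only [lucasNumber, Nat.fib_add_two] at *
      omega
  rw [Nat.fib_two_mul, ← (h n).1, Nat.add_sub_cancel]

/-- The Lucas numbers with integer index. -/
def intLucas (a : ℤ) : ℤ := 2 * Int.fib (a + 1) - Int.fib a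

theorem neg_one_pow_eq_intFib (p : ℕ) :
    (-1 : ℤ) ^ p = Int.fib (p + 1) ^ 2 - Int.fib p * Int.fib (p + 1) - Int.fib p ^ 2 := by
  have h : ∀ p : ℕ, ((p : ℤ) + 1) = ((p + 1 : ℕ) : ℤ) := fun _ => rfl
  rw [h, Int.fib_natCast, Int.fib_natCast]
  exact_mod_cast neg_one_pow_eq_cast_fib p

/-- The sum in the resistance formula, in closed form. -/
theorem sum_fib_eq_lucas (m : ℤ) (k : ℕ) (hk : 2 ≤ k) :
    25 * ∑ j ∈ Finset.Icc 3 k, (-1 : ℤ) ^ j * Int.fib (m - 2 * j + 3) *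
        (Int.fib (m + 2) + Int.fib (j - 2) * Int.fib (m - j + 1)) =
      ((-1) ^ k * intLucas (m - 2 * k + 2) - intLucas (m - 2)) *
        (5 * Int.fib (m + 2) + intLucas m + (-1) ^ k * intLucas (m - 2 * k + 2)) := by
  induction k, hk using Nat.le_induction with
  | base => simp; ring_nf; simp
  | succ k hk ih =>
    rw [Finset.sum_Icc_succ_top (by omega), mul_add, ih]
    obtain ⟨p, rfl⟩ : ∃ p, k = p + 1 := ⟨k - 1, by omega⟩
    obtain ⟨c, rfl⟩ : ∃ c : ℤ, m = c + 2 * p + 1 := ⟨m - 2 * p - 1, by ring⟩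
    have hs := neg_one_pow_eq_intFib p
    have hp : Int.fib ((p : ℤ) - 1) = Int.fib (p + 1) - Int.fib p := by
      rw [Int.fib_eq_fib_add_two_sub_fib_add_one]; ring_nf
    have h1 : Int.fib (p + c) = (Int.fib (p + 1) - Int.fib p) * Int.fib c +
        Int.fib p * Int.fib (c + 1) := by
      rw [Int.fib_add, hp]
    have h2 : Int.fib (p + c + 1) = Int.fib p * Int.fib c + Int.fib (p + 1) * Int.fib (c + 1) := by
      rw [show (p + c + 1 : ℤ) = (p + 1) + c by ring, Int.fib_add]; ring_nf
    have h3 : Int.fib (2 * p + c) = (Int.fib (p + 1) - Int.fib p) * Int.fib (p + c) +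
        Int.fib p * Int.fib (p + c + 1) := by
      rw [show (2 * p + c : ℤ) = p + (p + c) by ring, Int.fib_add, hp]
    have h4 : Int.fib (2 * p + c + 1) = Int.fib p * Int.fib (p + c) +
        Int.fib (p + 1) * Int.fib (p + c + 1) := by
      rw [show (2 * p + c + 1 : ℤ) = (p + 1) + (p + c) by ring, Int.fib_add]; ring_nf
    have f2 := Int.fib_add_two (2 * p + c)
    have f3 := Int.fib_add_two (2 * p + c + 1)
    have f1 := Int.fib_add_two (2 * p + c - 1)
    have g2 := Int.fib_add_two c
    have g1 := Int.fib_add_two (c - 1)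
    -- The product formula `5 F_p F_{p+c} = L_{2p+c} - (-1)^p L_c`.
    have key : 5 * Int.fib p * Int.fib (p + c) = 2 * Int.fib (2 * p + c + 1) - Int.fib (2 * p + c) -
        (-1) ^ p * (2 * Int.fib (c + 1) - Int.fib c) := by
      rw [h4, h3, h2, h1, hs]; ring
    simp only [intLucas]
    push_cast
    rw [show (c + 2 * p + 1 - 2 * (p + 1) + 2 + 1 : ℤ) = c + 2 by ring,
      show (c + 2 * p + 1 - 2 * (p + 1) + 2 : ℤ) = c + 1 by ring,
      show (c + 2 * p + 1 - 2 * (p + 1 + 1) + 2 + 1 : ℤ) = c - 1 + 1 by ring,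
      show (c + 2 * p + 1 - 2 * (p + 1 + 1) + 2 : ℤ) = c - 1 by ring,
      show (c + 2 * p + 1 - 2 * (p + 1 + 1) + 3 : ℤ) = c by ring,
      show (c + 2 * p + 1 - 2 + 1 : ℤ) = 2 * p + c by ring,
      show (c + 2 * p + 1 - 2 : ℤ) = 2 * p + c - 1 by ring,
      show (c + 2 * p + 1 + 2 : ℤ) = 2 * p + c + 1 + 2 by ring,
      show (c + 2 * p + 1 + 1 : ℤ) = 2 * p + c + 2 by ring,
      show (c + 2 * p + 1 - (p + 1 + 1) + 1 : ℤ) = p + c by ring,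
      show (c + 2 * p + 1 : ℤ) = 2 * p + c + 1 by ring,
      show (p + 1 + 1 - 2 : ℤ) = p by ring, f3, f2, g2]
    rw [show (2 * p + c - 1 + 2 : ℤ) = 2 * p + c + 1 by ring,
      show (2 * p + c - 1 + 1 : ℤ) = 2 * p + c by ring] at f1
    rw [show (c - 1 + 2 : ℤ) = c + 1 by ring, sub_add_cancel] at g1
    rw [sub_add_cancel, eq_sub_of_add_eq f1.symm, eq_sub_of_add_eq g1.symm, pow_succ, pow_succ]
    -- With `u_k = (-1)^k L_{m-2k+2}`, the increment `u_{k+1} - u_k` is `5 (-1)^p F_c`, since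
    -- `L_{c-1} + L_{c+1} = 5 F_c`. It factors out of the difference of the closed forms, leaving
    -- `key`.
    linear_combination (5 * (-1) ^ p * Int.fib c) * key

theorem neg_one_pow_mul_intLucas_sub (K Q : ℕ) :
    (-1) ^ K * intLucas (Q - K) = 2 * Nat.fib (Q + 1) * Nat.fib (K + 1) -
      2 * Nat.fib Q * Nat.fib K - Nat.fib (Q + 1) * Nat.fib K - Nat.fib Q * Nat.fib (K + 1) := by
  have hs : (-1 : ℤ) ^ K * (-1) ^ K = 1 := by rw [← mul_pow]; simp
  have h0 := Int.fib_add (-K) Q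
  have h1 := Int.fib_add (-K) (Q + 1)
  have e : (-(K : ℤ) - 1) = -((K + 1 : ℕ) : ℤ) := by push_cast; ring
  have e1 : Int.fib ((Q : ℤ) + 1) = Nat.fib (Q + 1) := Int.fib_natCast (Q + 1)
  have e2 : Int.fib ((Q : ℤ) + 1 + 1) = Nat.fib Q + Nat.fib (Q + 1) := by
    rw [← Nat.cast_add, ← Nat.fib_add_two]; exact Int.fib_natCast (Q + 2)
  rw [e, Int.fib_neg_natCast, Int.fib_neg_natCast, e1, Int.fib_natCast, pow_succ, pow_succ] at h0
  rw [e, Int.fib_neg_natCast, Int.fib_neg_natCast, e2, e1, pow_succ, pow_succ] at h1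
  rw [intLucas, show (Q : ℤ) - K + 1 = -K + (Q + 1) by ring, show (Q : ℤ) - K = -K + Q by ring,
    h0, h1]
  linear_combination (2 * Nat.fib (Q + 1) * Nat.fib (K + 1) -
      2 * Nat.fib Q * Nat.fib K - Nat.fib (Q + 1) * Nat.fib K - Nat.fib Q * Nat.fib (K + 1) : ℤ) * hs

theorem intLucas_natCast (n : ℕ) : intLucas n = 2 * Nat.fib (n + 1) - Nat.fib n := by
  rw [intLucas, Int.fib_natCast, show (n : ℤ) + 1 = (n + 1 : ℕ) from rfl, Int.fib_natCast]

/-- The addition formula with `F_{K-1}` eliminated, arranged to avoid subtraction in `ℕ`. -/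
theorem fib_add_eq (K Q : ℕ) : Nat.fib (K + Q) + Nat.fib K * Nat.fib Q =
    Nat.fib (K + 1) * Nat.fib Q + Nat.fib K * Nat.fib (Q + 1) := by
  rcases K with _ | K
  · simp
  · rw [show K + 1 + Q = K + Q + 1 by ring, Nat.fib_add, Nat.fib_add_two]; ring

/-- The numerator of the resistance formula in terms of Fibonacci numbers of even and odd index. -/
theorem resistance_numerator_eq (K Q : ℕ) (p₀ p₁ r₀ r₁ s t : ℝ)
    (hp₀ : p₀ = Nat.fib (2 * K)) (hp₁ : p₁ = Nat.fib (2 * K + 1))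
    (hr₀ : r₀ = Nat.fib (2 * Q)) (hr₁ : r₁ = Nat.fib (2 * Q + 1))
    (hs : s = (-1) ^ K) (ht : t = (-1) ^ Q) :
    20 * (Nat.fib (K + Q + 5) : ℝ) ^ 2 + 25 * (∑ j ∈ Finset.Icc 3 (K + 3), (-1 : ℝ) ^ j *
        (Int.fib (((K + Q + 4 : ℕ) : ℤ) - 2 * j + 3) : ℝ) *
          ((Int.fib ((K + Q + 4 : ℕ) + 2) : ℝ) + (Int.fib ((j : ℤ) - 2) : ℝ) *
            (Int.fib (((K + Q + 4 : ℕ) : ℤ) - j + 1) : ℝ))) =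
      3 * (123 * (p₀ * r₀ + p₁ * r₁) + 76 * (p₁ * r₀ + p₀ * r₁ - p₀ * r₀)) +
        (2 * r₁ * p₁ - 2 * r₀ * p₀ - r₁ * p₀ - r₀ * p₁) - 8 * s * t -
        s * (28 * r₀ + 44 * r₁) - t * (28 * p₀ + 44 * p₁) := by
  have hsum := sum_fib_eq_lucas (K + Q + 4 : ℕ) (K + 3) (by omega)
  rw [show ((K + Q + 4 : ℕ) : ℤ) - 2 * (K + 3 : ℕ) + 2 = Q - K by push_cast; ring,
    show ((-1 : ℤ)) ^ (K + 3) = -(-1) ^ K by ring, neg_mul, neg_one_pow_mul_intLucas_sub,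
    show ((K + Q + 4 : ℕ) : ℤ) - 2 = (K + Q + 2 : ℕ) by push_cast; ring,
    show ((K + Q + 4 : ℕ) : ℤ) + 2 = (K + Q + 6 : ℕ) by push_cast; ring,
    intLucas_natCast, intLucas_natCast, Int.fib_natCast] at hsum
  have hsum' := congrArg (Int.cast : ℤ → ℝ) hsum
  rw [show ((K + Q + 4 : ℕ) : ℤ) + 2 = (K + Q + 6 : ℕ) by push_cast; ring, Int.fib_natCast]
  push_cast at hsum' ⊢
  rw [hsum']
  have a0 : (Nat.fib (K + Q) : ℝ) = Nat.fib (K + 1) * Nat.fib Q + Nat.fib K * Nat.fib (Q + 1) -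
      Nat.fib K * Nat.fib Q := by
    rw [eq_sub_iff_add_eq]; exact_mod_cast fib_add_eq K Q
  have a1 : (Nat.fib (K + Q + 1) : ℝ) = Nat.fib K * Nat.fib Q + Nat.fib (K + 1) * Nat.fib (Q + 1) :=
    by exact_mod_cast Nat.fib_add K Q
  have b0 : ∀ n, (Nat.fib (2 * n) : ℝ) = Nat.fib n * (2 * Nat.fib (n + 1) - Nat.fib n) := by
    intro n
    have := fib_add_eq n n
    rw [← two_mul] at this
    have := congrArg (Nat.cast : ℕ → ℝ) this
    push_cast at this
    linarith
  have b1 : ∀ n, (Nat.fib (2 * n + 1) : ℝ) = Nat.fib (n + 1) ^ 2 + Nat.fib n ^ 2 := by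
    intro n; exact_mod_cast Nat.fib_two_mul_add_one n
  rw [hp₀, hp₁, hr₀, hr₁, hs, ht, neg_one_pow_eq_cast_fib, neg_one_pow_eq_cast_fib, b0, b0, b1, b1]
  have f : ∀ c, (Nat.fib (K + Q + (c + 2)) : ℝ) = Nat.fib (K + Q + c) + Nat.fib (K + Q + (c + 1)) :=
    fun c => by exact_mod_cast Nat.fib_add_two
  simp only [Nat.add_assoc _ _ 1, Nat.reduceAdd]
  rw [f 4, f 3, f 2, f 1, f 0, a1, Nat.add_zero (K + Q), a0]
  ring

/-! ### Solving the balance equations at the bend -/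

/-- With `α` and `β` chosen by Cramer's rule the potentials of the two arms satisfy the balance
equations at the bend, and the total potential drop `-C` is determined. -/
theorem gluing_identities (K Q p₀ p₁ r₀ r₁ s t D α β A B C X₀ X₁ X₂ X₃ Y₀ Y₁ Y₂ Y₃ : ℝ)
    (hs : s ^ 2 = 1) (ht : t ^ 2 = 1)
    (hp : p₁ ^ 2 - p₀ * p₁ - p₀ ^ 2 = 1) (hr : r₁ ^ 2 - r₀ * r₁ - r₀ ^ 2 = 1) (hD0 : D ≠ 0)
    (hD : D = (3 * p₀ + 5 * p₁) * (2 * r₀ + 3 * r₁) + (3 * r₀ + 5 * r₁) * (5 * p₀ + 8 * p₁))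
    (hA : A = -2 * (1 - s * (5 * p₀ + 8 * p₁) - t * (5 * r₀ + 8 * r₁)))
    (hB : B = -1 + 2 * (s * (8 * p₀ + 13 * p₁) - t * (3 * r₀ + 5 * r₁)))
    (hα : 5 * D * α = s * (A * (-2 * r₀ - 3 * r₁) - B * (3 * r₀ + 5 * r₁)))
    (hβ : 5 * D * β = t * ((3 * p₀ + 5 * p₁) * B - (5 * p₀ + 8 * p₁) * A))
    (hX₀ : X₀ = 2/25 + 2*α/5 - K/5 + s * ((α/5 - 4/25) * p₀ - (2/25 + 2*α/5) * p₁))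
    (hX₁ : X₁ = 2/25 + 2*α/5 - (K+1)/5 -
      s * ((α/5 - 4/25) * (p₀ + p₁) - (2/25 + 2*α/5) * (p₀ + 2*p₁)))
    (hX₂ : X₂ = 2/25 + 2*α/5 - (K+2)/5 +
      s * ((α/5 - 4/25) * (2*p₀ + 3*p₁) - (2/25 + 2*α/5) * (3*p₀ + 5*p₁)))
    (hX₃ : X₃ = 2/25 + 2*α/5 - (K+3)/5 -
      s * ((α/5 - 4/25) * (5*p₀ + 8*p₁) - (2/25 + 2*α/5) * (8*p₀ + 13*p₁)))
    (hY₀ : Y₀ = 2/25 + 2*β/5 - Q/5 + t * ((β/5 - 4/25) * r₀ - (2/25 + 2*β/5) * r₁))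
    (hY₁ : Y₁ = 2/25 + 2*β/5 - (Q+1)/5 -
      t * ((β/5 - 4/25) * (r₀ + r₁) - (2/25 + 2*β/5) * (r₀ + 2*r₁)))
    (hY₂ : Y₂ = 2/25 + 2*β/5 - (Q+2)/5 +
      t * ((β/5 - 4/25) * (2*r₀ + 3*r₁) - (2/25 + 2*β/5) * (3*r₀ + 5*r₁)))
    (hY₃ : Y₃ = 2/25 + 2*β/5 - (Q+3)/5 -
      t * ((β/5 - 4/25) * (5*r₀ + 8*r₁) - (2/25 + 2*β/5) * (8*r₀ + 13*r₁)))
    (hC : C = X₃ + Y₃) :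
    X₂ = C - Y₂ ∧ 5*X₂ - X₀ - X₁ - X₃ - (C - Y₁) - (C - Y₀) = 0 ∧
    3*X₃ - X₁ - X₂ - (C - Y₁) = 0 ∧
    25 * D * (-C) = 5 * (K + Q + 5) * D +
      (3 * (123 * (p₀ * r₀ + p₁ * r₁) + 76 * (p₁ * r₀ + p₀ * r₁ - p₀ * r₀)) +
        (2 * r₁ * p₁ - 2 * r₀ * p₀ - r₁ * p₀ - r₀ * p₁) - 8 * s * t -
        s * (28 * r₀ + 44 * r₁) - t * (28 * p₀ + 44 * p₁)) := by
  -- `e₁` is agreement at the bend vertex and `e₂` balance at the next one, with `C` and `Y₃`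
  -- eliminated. `A` and `B` are `-5` times their left sides at `α = β = 0`.
  have e₁ : X₂ - X₃ + (Y₂ - Y₃) = 0 := by
    apply mul_left_cancel₀ hD0
    subst hX₂ hX₃ hY₂ hY₃
    linear_combination (-s * (3*p₀ + 5*p₁)) / 5 * hα + (-t * (3*r₀ + 5*r₁)) / 5 * hβ
      - ((3*p₀ + 5*p₁) * (A * (-2*r₀ - 3*r₁) - B * (3*r₀ + 5*r₁))) / 5 * hs
      - ((3*r₀ + 5*r₁) * ((3*p₀ + 5*p₁) * B - (5*p₀ + 8*p₁) * A)) / 5 * ht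
      - A / 5 * hD + D / 5 * hA
  have e₂ : X₂ - 2 * X₃ + X₁ + Y₁ - 2 * Y₂ + Y₀ - 1 = 0 := by
    apply mul_left_cancel₀ hD0
    subst hX₁ hX₂ hX₃ hY₀ hY₁ hY₂
    linear_combination (-s * (5*p₀ + 8*p₁)) / 5 * hα + (-t * (-2*r₀ - 3*r₁)) / 5 * hβ
      - ((5*p₀ + 8*p₁) * (A * (-2*r₀ - 3*r₁) - B * (3*r₀ + 5*r₁))) / 5 * hs
      - ((-2*r₀ - 3*r₁) * ((3*p₀ + 5*p₁) * B - (5*p₀ + 8*p₁) * A)) / 5 * ht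
      - B / 5 * hD + D / 5 * hB
  -- Unit current crosses a cut in each arm; this makes the second balance equation redundant.
  have cX : X₀ + 2 * X₁ - 2 * X₂ - X₃ = 1 := by subst hX₀ hX₁ hX₂ hX₃; ring
  have cY : Y₀ + 2 * Y₁ - 2 * Y₂ - Y₃ = 1 := by subst hY₀ hY₁ hY₂ hY₃; ring
  refine ⟨by linarith, by linarith, by linarith, ?_⟩
  -- Here `a` and `b` stand for `5 D α` and `5 D β`, so the claim is polynomial, modulo `s² = t² =
  -- 1` and Cassini.
  have hJ : ∀ a b, a = s * (A * (-2 * r₀ - 3 * r₁) - B * (3 * r₀ + 5 * r₁)) →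
      b = t * ((3 * p₀ + 5 * p₁) * B - (5 * p₀ + 8 * p₁) * A) →
      -7*D - 2*a - 2*b + 2*s*(2*p₀ + 3*p₁)*D + s*(p₀ + 2*p₁)*a + 2*t*(2*r₀ + 3*r₁)*D +
        t*(r₀ + 2*r₁)*b =
      3 * (123 * (p₀ * r₀ + p₁ * r₁) + 76 * (p₁ * r₀ + p₀ * r₁ - p₀ * r₀)) +
        (2 * r₁ * p₁ - 2 * r₀ * p₀ - r₁ * p₀ - r₀ * p₁) - 8 * s * t -
        s * (28 * r₀ + 44 * r₁) - t * (28 * p₀ + 44 * p₁) := by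
    intro a b ha hb
    clear hα hβ hD0 e₁ e₂ cX cY hX₀ hX₁ hX₂ hX₃ hY₀ hY₁ hY₂ hY₃ hC
    subst hA hB ha hb hD
    grind
  rw [← hJ _ _ hα hβ, hC]
  -- Adding this multiple of `e₁` reduces the coefficients to the form in `hJ`.
  have e₃ : 25 * D * (-(X₃ + Y₃)) = 25 * D * (-(X₃ + Y₃)) - 20 * D * (X₂ - X₃ + (Y₂ - Y₃)) := by
    rw [e₁]; ring
  rw [e₃]
  subst hX₂ hX₃ hY₂ hY₃
  ring

/-! ### Assembling the formula -/

theorem straightPotential_add (α : ℝ) (K : ℕ) (p₀ p₁ s : ℝ)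
    (hp₀ : p₀ = Nat.fib (2 * K)) (hp₁ : p₁ = Nat.fib (2 * K + 1)) (hs : s = (-1) ^ K) :
    straightPotential α K = 2/25 + 2*α/5 - K/5 + s * ((α/5 - 4/25) * p₀ - (2/25 + 2*α/5) * p₁) ∧
    straightPotential α (K + 1) = 2/25 + 2*α/5 - (K+1)/5 -
      s * ((α/5 - 4/25) * (p₀ + p₁) - (2/25 + 2*α/5) * (p₀ + 2*p₁)) ∧
    straightPotential α (K + 2) = 2/25 + 2*α/5 - (K+2)/5 +
      s * ((α/5 - 4/25) * (2*p₀ + 3*p₁) - (2/25 + 2*α/5) * (3*p₀ + 5*p₁)) ∧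
    straightPotential α (K + 3) = 2/25 + 2*α/5 - (K+3)/5 -
      s * ((α/5 - 4/25) * (5*p₀ + 8*p₁) - (2/25 + 2*α/5) * (8*p₀ + 13*p₁)) := by
  subst hp₀ hp₁ hs
  refine ⟨rfl, ?_, ?_, ?_⟩ <;>
  · simp [straightPotential, Nat.mul_add, Nat.fib_add_two, pow_add]
    ring

theorem mainTheorem1 (n m k : ℕ) (hm : n = m + 2) (hk : 3 ≤ k) (hkn : k + 3 ≤ n) :
    resistanceDistance (bentLinearTwoTree n k)
        (⟨0, by omega⟩ : Fin n) (⟨n - 1, by omega⟩ : Fin n) =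
      ((m : ℝ) + 1) / 5 + 4 * (Int.fib (m + 1) : ℝ) / (5 * (lucasNumber (m + 1) : ℝ)) +
        (∑ j ∈ Finset.Icc 3 k, (-1 : ℝ) ^ j * (Int.fib ((m : ℤ) - 2 * j + 3) : ℝ) *
          ((Int.fib (m + 2) : ℝ) + (Int.fib ((j : ℤ) - 2) : ℝ) * (Int.fib ((m : ℤ) - j + 1) : ℝ))) /
        (Int.fib (2 * m + 2) : ℝ) := by
  obtain ⟨K, rfl⟩ : ∃ K, k = K + 3 := ⟨k - 3, by omega⟩
  obtain ⟨Q, rfl⟩ : ∃ Q, m = K + Q + 4 := ⟨m - K - 4, by omega⟩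
  subst hm
  obtain ⟨p₀, hp₀⟩ : ∃ p₀ : ℝ, p₀ = Nat.fib (2 * K) := ⟨_, rfl⟩
  obtain ⟨p₁, hp₁⟩ : ∃ p₁ : ℝ, p₁ = Nat.fib (2 * K + 1) := ⟨_, rfl⟩
  obtain ⟨r₀, hr₀⟩ : ∃ r₀ : ℝ, r₀ = Nat.fib (2 * Q) := ⟨_, rfl⟩
  obtain ⟨r₁, hr₁⟩ : ∃ r₁ : ℝ, r₁ = Nat.fib (2 * Q + 1) := ⟨_, rfl⟩
  obtain ⟨s, hs⟩ : ∃ s : ℝ, s = (-1) ^ K := ⟨_, rfl⟩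
  obtain ⟨t, ht⟩ : ∃ t : ℝ, t = (-1) ^ Q := ⟨_, rfl⟩
  obtain ⟨A, hA⟩ : ∃ A : ℝ, A = -2 * (1 - s * (5 * p₀ + 8 * p₁) - t * (5 * r₀ + 8 * r₁)) :=
    ⟨_, rfl⟩
  obtain ⟨B, hB⟩ : ∃ B : ℝ, B = -1 + 2 * (s * (8 * p₀ + 13 * p₁) - t * (3 * r₀ + 5 * r₁)) :=
    ⟨_, rfl⟩
  have hD : (Nat.fib (2 * (K + Q + 4) + 2) : ℝ) =
      (3 * p₀ + 5 * p₁) * (2 * r₀ + 3 * r₁) + (3 * r₀ + 5 * r₁) * (5 * p₀ + 8 * p₁) := by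
    -- The addition formula splits `F_{2m+2}` as `F_{2K+5} F_{2Q+4} + F_{2K+6} F_{2Q+5}`.
    rw [show 2 * (K + Q + 4) + 2 = (2 * K + 4) + (2 * Q + 5) + 1 by ring, Nat.fib_add, hp₀, hp₁,
      hr₀, hr₁]
    simp [Nat.fib_add_two]
    ring
  have hD0 : (Nat.fib (2 * (K + Q + 4) + 2) : ℝ) ≠ 0 := by
    exact_mod_cast (Nat.fib_pos.2 (by omega)).ne'
  have hfl : (Nat.fib (2 * (K + Q + 4) + 2) : ℝ) =
      Nat.fib (K + Q + 5) * lucasNumber (K + Q + 4 + 1) := by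
    exact_mod_cast fib_two_mul_eq_mul_lucasNumber (K + Q + 5)
  have hcassini : ∀ j : ℕ, (Nat.fib (2 * j + 1) : ℝ) ^ 2 - Nat.fib (2 * j) * Nat.fib (2 * j + 1) -
      (Nat.fib (2 * j) : ℝ) ^ 2 = 1 := fun j => by
    rw [← neg_one_pow_eq_cast_fib, pow_mul]; simp
  obtain ⟨D, hDdef⟩ : ∃ D : ℝ, D = Nat.fib (2 * (K + Q + 4) + 2) := ⟨_, rfl⟩
  rw [← hDdef] at hD hD0 hfl
  obtain ⟨α, hα⟩ : ∃ α : ℝ, 5 * D * α =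
      s * (A * (-2 * r₀ - 3 * r₁) - B * (3 * r₀ + 5 * r₁)) :=
    ⟨_, mul_inv_cancel_left₀ (mul_ne_zero (by norm_num) hD0) _⟩
  obtain ⟨β, hβ⟩ : ∃ β : ℝ, 5 * D * β =
      t * ((3 * p₀ + 5 * p₁) * B - (5 * p₀ + 8 * p₁) * A) :=
    ⟨_, mul_inv_cancel_left₀ (mul_ne_zero (by norm_num) hD0) _⟩
  obtain ⟨hX₀, hX₁, hX₂, hX₃⟩ := straightPotential_add α K p₀ p₁ s hp₀ hp₁ hs
  obtain ⟨hY₀, hY₁, hY₂, hY₃⟩ := straightPotential_add β Q r₀ r₁ t hr₀ hr₁ ht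
  obtain ⟨C, hC⟩ : ∃ C, C = straightPotential α (K + 3) + straightPotential β (Q + 3) := ⟨_, rfl⟩
  obtain ⟨h₂, hb₂, hb₃, hfin⟩ := gluing_identities K Q p₀ p₁ r₀ r₁ s t D α β A B C _ _ _ _ _ _ _ _
    (by rw [hs, ← pow_mul, mul_comm, pow_mul]; simp)
    (by rw [ht, ← pow_mul, mul_comm, pow_mul]; simp)
    (by rw [hp₀, hp₁]; exact hcassini K) (by rw [hr₀, hr₁]; exact hcassini Q)
    hD0 hD hA hB hα hβ hX₀ hX₁ hX₂ hX₃ hY₀ hY₁ hY₂ hY₃ hC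
  have hres := resistanceDistance_bentLinearTwoTree_of_potentials K Q (straightPotential α)
    (straightPotential β) C (straightPotential_end α) (straightPotential_next α)
    (straightPotential_inner α) (straightPotential_end β) (straightPotential_next β)
    (straightPotential_inner β) h₂ (by rw [hC]; ring) hb₂ hb₃
  rw [straightPotential_zero, straightPotential_zero] at hres
  refine hres.trans ?_
  rw [← resistance_numerator_eq K Q p₀ p₁ r₀ r₁ s t hp₀ hp₁ hr₀ hr₁ hs ht] at hfin
  have i₁ : Int.fib (2 * ((K + Q + 4 : ℕ) : ℤ) + 2) = Nat.fib (2 * (K + Q + 4) + 2) :=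
    Int.fib_natCast (2 * (K + Q + 4) + 2)
  have i₂ : Int.fib (((K + Q + 4 : ℕ) : ℤ) + 1) = Nat.fib (K + Q + 5) :=
    Int.fib_natCast (K + Q + 5)
  rw [i₁, i₂]
  simp only [Int.cast_natCast]
  rw [← hDdef]
  generalize (∑ j ∈ Finset.Icc 3 (K + 3), _ : ℝ) = S at hfin ⊢
  have hL0 : (lucasNumber (K + Q + 4 + 1) : ℝ) ≠ 0 := by
    intro h; rw [h, mul_zero] at hfl; exact hD0 hfl
  -- `F_{2m+2} = F_{m+1} L_{m+1}` brings the Lucas term over the denominator `D`.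
  have hq : 4 * (Nat.fib (K + Q + 5) : ℝ) / (5 * lucasNumber (K + Q + 4 + 1)) =
      4 * (Nat.fib (K + Q + 5) : ℝ) ^ 2 / (5 * D) := by
    rw [div_eq_div_iff (by positivity) (by positivity), hfl]; ring
  rw [hq]
  field_simp
  push_cast
  linear_combination hfin / 5
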